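/- **Conventions.** Cardinals are initial ordinals and are identified with the set of ordinals below them. An infinite cardinal is regular if it equals its own cofinality. Let $\mathbf a=(\lambda_i)_{i\in I}$ be a family of cardinals. $\prod\mathbf a$ is the cartesian product $\prod_{i\in I}\lambda_i$, ordered pointwise. For an ultrafilter $U$ on $I$, the ultraproduct $\prod\mathbf a/U$ is the set of functions in $\prod\mathbf a$ modulo equality on a set in $U$, ordered by $f\le g$ iff $\{i: f(i)\le g(i)\}\in U$. The cofinality $\operatorname{cof}P$ of a partially ordered set $P$ is the least cardinality of a subset $D\subseteq P$ such that every element of $P$ is $\le$ some element of $D$. A cardinal $\mu$ is a *possible cofinality* of $\prod\mathbf a$ if $\mu=\operatorname{cof}(\prod\mathbf a/U)$ for some ultrafilter $U$ on $I$, and $\operatorname{pcf}\mathbf a$ is the set of all possible cofinalities. For $\mathbf b\subseteq I$ we write $\operatorname{pcf}\mathbf b$ for $\operatorname{pcf}\,(\lambda_i)_{i\in \mathbf b}$, and $\mathbf a-\mathbf b$ for $I\setminus \mathbf b$. (When the $\lambda_i$ are distinct, subsets of $I$ are the same as subsets of $\mathbf a$.) The ideal on $I$ generated by a collection of subsets of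 $I$ is the least nonempty collection of subsets of $I$ that includes it and is closed under subsets and finite unions. For an ideal $J$ on $I$ and $f,g\in\prod\mathbf a$, "$f<g \bmod J$" means $\{i\in I: f(i)\not< g(i)\}\in J$. **Theorem.** Let $I$ be a nonempty set and let $\mathbf a=(\lambda_i)_{i\in I}$ be a family of distinct regular cardinals with $\lambda_i>|I|$ for all $i\in I$. Then: 1. $\operatorname{pcf}\mathbf a$ contains at most $2^{|I|}$ cardinals. 2. $\operatorname{pcf}\mathbf a$ has a largest element $\max\operatorname{pcf}\mathbf a$. 3. $\operatorname{cof}\prod\mathbf a=\max\operatorname{pcf}\mathbf a$. 4. For each $\lambda\in\operatorname{pcf}\mathbf a$ there is a subset $\mathbf b_\lambda\subseteq\mathbf a$ such that (a) $\lambda=\max\operatorname{pcf}\mathbf b_\lambda$, and (b) $\lambda\notin\operatorname{pcf}(\mathbf a-\mathbf b_\lambda)$. 5. Let $(\mathbf b_\lambda)_{\lambda\in\operatorname{pcf}\mathbf a}$ be any family of subsets of $\mathbf a$ as in 4, and for $\lambda\in\operatorname{pcf}\mathbf a$ let $J_\lambda$ be the ideal on $I$ generated by the sets $\mathbf b_\mu$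 for $\mu\in\operatorname{pcf}\mathbf a$, $\mu<\lambda$. Then for each $\lambda\in\operatorname{pcf}\mathbf a$ there are functions $f^\lambda_i\in\prod\mathbf a$ $(i<\lambda)$ such that (a) $f^\lambda_i<f^\lambda_j \bmod J_\lambda$ for all $i<j<\lambda$, and (b) for every $f\in\prod\mathbf a$ there is some $i<\lambda$ such that $f<f^\lambda_i \bmod \langle J_\lambda,\ \mathbf a-\mathbf b_\lambda\rangle$, the ideal generated by $J_\lambda$ together with the set $\mathbf a-\mathbf b_\lambda$. -/

import Mathlib

open scoped Cardinal

universe u v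

namespace PCF

/-- The order on the reduced product `∏ X i / F`: pointwise comparison modulo `F`. -/
instance reducedProductPartialOrder {I : Type u} (F : Filter I) (X : I → Type v)
    [∀ i, PartialOrder (X i)] : PartialOrder (F.Product X) where
  le := fun a b => Quotient.liftOn₂ a b (fun f g => ∀ᶠ i in F, f i ≤ g i) (by
    intro f g f' g' hf hg
    have hf' : ∀ᶠ i in F, f i = f' i := hf
    have hg' : ∀ᶠ i in F, g i = g' i := hg
    refine propext ⟨fun h => ?_, fun h => ?_⟩
    · filter_upwards [h, hf', hg'] with i h1 h2 h3
      rwa [← h2, ← h3]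
    · filter_upwards [h, hf', hg'] with i h1 h2 h3
      rwa [h2, h3])
  le_refl := by
    intro a
    induction a using Quotient.inductionOn with
    | h f => exact Filter.Eventually.of_forall fun i => le_refl (f i)
  le_trans := by
    intro a b c
    induction a using Quotient.inductionOn with
    | h f =>
      induction b using Quotient.inductionOn with
      | h g =>
        induction c using Quotient.inductionOn with
        | h k =>
          intro h1 h2
          have h1' : ∀ᶠ i in F, f i ≤ g i := h1
          have h2' : ∀ᶠ i in F, g i ≤ k i := h2
          have h3 : ∀ᶠ i in F, f i ≤ k i := by
            filter_upwards [h1', h2'] with i x y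
            exact le_trans x y
          exact h3
  le_antisymm := by
    intro a b
    induction a using Quotient.inductionOn with
    | h f =>
      induction b using Quotient.inductionOn with
      | h g =>
        intro h1 h2
        have h1' : ∀ᶠ i in F, f i ≤ g i := h1
        have h2' : ∀ᶠ i in F, g i ≤ f i := h2
        refine Quotient.sound ?_
        have h3 : ∀ᶠ i in F, f i = g i := by
          filter_upwards [h1', h2'] with i x y
          exact le_antisymm x y
        exact h3

/-- The factor of the product that belongs to the index `i`: the cardinal `a i`, thought of as
the set of the ordinals below it, with their order. -/
abbrev Factor {I : Type u} (a : I → Cardinal.{v}) (i : I) : Type v := (a i).ord.ToType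

/-- The cartesian product `∏ a`; as an order it carries pointwise comparison. -/
abbrev CartProd {I : Type u} (a : I → Cardinal.{v}) : Type (max u v) := ∀ i, Factor a i

/-- `pcf a`: the set of the possible cofinalities of `∏ a`, that is, of the cofinalities of the
ultraproducts `∏ a / U`, where `U` is an ultrafilter on the index set. -/
def pcf {I : Type u} (a : I → Cardinal.{u}) : Set Cardinal.{u} :=
  {μ | ∃ U : Ultrafilter I, Order.cof ((U : Filter I).Product (Factor a)) = μ}

/-- `pcf` of the subfamily of `a` with index set `b`. -/
def pcfOn {I : Type u} (a : I → Cardinal.{u}) (b : Set I) : Set Cardinal.{u} :=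
  pcf fun i : b => a i

/-- The ideal of subsets of `I` generated by a collection `S` of subsets of `I`: the least
nonempty collection that includes `S` and is closed under subsets and binary unions. -/
def idealGen {I : Type u} (S : Set (Set I)) : Order.Ideal (Set I) :=
  sInf {J : Order.Ideal (Set I) | S ⊆ (J : Set (Set I))}

/-- `f < g mod J`, for an ideal `J` of subsets of `I`. -/
def LtMod {I : Type u} {a : I → Cardinal.{u}} (J : Order.Ideal (Set I)) (f g : CartProd a) : Prop :=
  {i | ¬ f i < g i} ∈ J

/-- The indexed sets `b μ`, for `μ` in `pcf a`, are generators: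
`μ = max pcf (b μ)` and `μ ∉ pcf (a - b μ)`. -/
def IsGenerators {I : Type u} (a : I → Cardinal.{u}) (b : Cardinal.{u} → Set I) : Prop :=
  ∀ μ ∈ pcf a, IsGreatest (pcfOn a (b μ)) μ ∧ μ ∉ pcfOn a (b μ)ᶜ

/-- `J_μ`: the ideal generated by the sets `b ν` with `ν ∈ pcf a` and `ν < μ`. -/
def lowerIdeal {I : Type u} (a : I → Cardinal.{u}) (b : Cardinal.{u} → Set I)
    (μ : Cardinal.{u}) : Order.Ideal (Set I) :=
  idealGen {s | ∃ ν ∈ pcf a, ν < μ ∧ s = b ν}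

end PCF

/-! Everything is tested on ultrafilters. Fix `c` and neglect the sets on which all ultraproducts
have cofinality below `c`. Modulo these, fewer than `c` functions have a common bound
(`exists_bound`), and some increasing sequence of length `c` is cofinal in all ultraproducts of
cofinality `c` at once (`exists_universal`). Both hold because `κ` successive corrections of a
failing candidate, with `κ` regular and above `|I|`, would give a strictly decreasing chain of `κ`
subsets of `I`.

A generator for `c` is the set where a term of a universal sequence exceeds a function `g` that
bounds the sequence in all ultraproducts of cofinality above `c`. From some term on, this set must
not change essentially (`exists_stable`): this is the deep step, by club guessing at `κ⁺⁺`. It needs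
members above `κ⁺⁺`; the finitely many others matter only to principal ultrafilters.

The rest is compactness of the space of ultrafilters: a family of sets that meets every ultrafilter
has a finite subcover of `I`. -/

namespace PCF

section

/-! ### Well-orders and regular cardinals -/

section Orders

theorem exists_forall_lt_of_lt_cof {ι α : Type u} [LinearOrder α] (h : #ι < Order.cof α)
    (f : ι → α) : ∃ b, ∀ i, f i < b := by
  have : ¬ IsCofinal (Set.range f) := fun hc =>
    absurd (Order.cof_le hc) (not_le.2 (Cardinal.mk_range_le.trans_lt h))
  simp only [IsCofinal, not_forall, not_exists, not_and, Set.forall_mem_range, not_le] at this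
  exact this

theorem cof_toType_of_isRegular {c : Cardinal.{u}} (hc : c.IsRegular) :
    Order.cof c.ord.ToType = c := by
  rw [Ordinal.cof_toType, hc.cof_ord]

theorem exists_forall_lt {c : Cardinal.{u}} (hc : c.IsRegular) {ι : Type u} (h : #ι < c)
    (f : ι → c.ord.ToType) : ∃ b, ∀ i, f i < b :=
  exists_forall_lt_of_lt_cof (by rwa [cof_toType_of_isRegular hc]) f

theorem mk_Iio_lt {c : Cardinal.{u}} (x : c.ord.ToType) : #(Set.Iio x) < c := by
  simpa using Cardinal.mk_Iio_lt x (by simp)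

theorem mk_Iic_lt {c : Cardinal.{u}} (hc : ℵ₀ ≤ c) (x : c.ord.ToType) : #(Set.Iic x) < c := by
  rw [← Set.Iio_insert]
  exact (Cardinal.mk_insert_le).trans_lt
    (Cardinal.add_lt_of_lt hc (mk_Iio_lt x) (Cardinal.one_lt_aleph0.trans_le hc))

/-- Recursion along a well-order, subject to a prescribed relation to the earlier values. -/
theorem exists_forall_rel_of_wellFounded {L : Type u} [LinearOrder L] [WellFoundedLT L]
    {X : Type v} (R : (ξ : L) → (Set.Iio ξ → X) → X → Prop) (h : ∀ ξ p, ∃ x, R ξ p x) :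
    ∃ f : L → X, ∀ ξ, R ξ (fun η => f η) (f ξ) := by
  choose s hs using h
  let f : L → X := wellFounded_lt.fix fun ξ p => s ξ fun η => p η.1 η.2
  refine ⟨f, fun ξ => ?_⟩
  have : f ξ = s ξ fun η => f η := wellFounded_lt.fix_eq _ _
  rw [this]
  exact hs _ _

/-- Iteration of a map along a well-order, for a relation in which families indexed by that
well-order are bounded. -/
theorem exists_iterate {W : Type u} [LinearOrder W] [WellFoundedLT W] {P : Type v}
    [Nonempty P] (r : P → P → Prop) (hr : ∀ p : W → P, ∃ q, ∀ w, r (p w) q) (s : P → P) :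
    ∃ p : W → P, ∀ v w, v < w → r (s (p v)) (p w) := by
  obtain ⟨p, hp⟩ := exists_forall_rel_of_wellFounded (L := W) (X := P)
    (fun w p x => ∀ v, r (s (p v)) x) (fun w p => by
      classical
      obtain ⟨q, hq⟩ := hr fun v => if h : v < w then s (p ⟨v, h⟩) else Classical.arbitrary P
      refine ⟨q, fun v => ?_⟩
      have := hq v.1
      rwa [dif_pos (show v.1 < w from v.2)] at this)
  exact ⟨p, fun v w h => hp w ⟨v, h⟩⟩

/-- Otherwise each step to a successor loses a point of `I`, and the lost points are distinct. -/
theorem exists_lt_subset_of_antitone {I W : Type u} [LinearOrder W] [NoMaxOrder W]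
    [WellFoundedLT W]
    (h : #I < #W) (B : W → Set I) (hB : Antitone B) : ∃ v w, v < w ∧ B v ⊆ B w := by
  by_contra! hcon
  let := SuccOrder.ofLinearWellFoundedLT W
  have : ∀ v, ∃ i, i ∈ B v ∧ i ∉ B (Order.succ v) := fun v =>
    Set.not_subset.1 (hcon v _ (Order.lt_succ v))
  choose g hg hg' using this
  have hlt : ∀ v w, v < w → g v ≠ g w := fun v w hvw he =>
    hg' v (he ▸ hB (Order.succ_le_of_lt hvw) (hg w))
  have hinj : Function.Injective g := fun v w he => by
    rcases lt_trichotomy v w with h | h | h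
    · exact absurd he (hlt _ _ h)
    · exact h
    · exact absurd he.symm (hlt _ _ h)
  exact absurd (Cardinal.mk_le_of_injective hinj) (not_le.2 h)

theorem noMaxOrder_toType {c : Cardinal.{u}} (hc : ℵ₀ ≤ c) : NoMaxOrder c.ord.ToType := by
  exact Cardinal.noMaxOrder hc

end Orders

/-! ### Cofinalities of ultraproducts -/

variable {I : Type u} {a : I → Cardinal.{u}}

/-- The cofinality of the ultraproduct `∏ a / U`. -/
noncomputable def ucof (a : I → Cardinal.{u}) (U : Ultrafilter I) : Cardinal.{u} :=
  Order.cof ((U : Filter I).Product (Factor a))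

theorem exists_lt_pointwise (ha : ∀ i, (a i).IsRegular) (s : Set I) {ι : Type u}
    (h : ∀ i ∈ s, #ι < a i) (F : ι → CartProd a) : ∃ g : CartProd a, ∀ x, ∀ i ∈ s, F x i < g i := by
  have : ∀ i, ∃ b : Factor a i, i ∈ s → ∀ x, F x i < b := fun i => by
    by_cases hi : i ∈ s
    · obtain ⟨b, hb⟩ := exists_forall_lt (ha i) (h i hi) fun x => F x i
      exact ⟨b, fun _ => hb⟩
    · have : Nonempty (Factor a i) := by
        rw [Ordinal.nonempty_toType_iff]
        simpa using (ha i).pos.ne'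
      exact ⟨Classical.arbitrary _, fun h => absurd h hi⟩
  choose g hg using this
  exact ⟨g, fun x i hi => hg i hi x⟩

theorem exists_gt_pointwise (ha : ∀ i, (a i).IsRegular) (f : CartProd a) :
    ∃ g : CartProd a, ∀ i, f i < g i := by
  obtain ⟨g, hg⟩ := exists_lt_pointwise ha Set.univ (ι := PUnit)
    (fun i _ => by simpa using Cardinal.one_lt_aleph0.trans_le (ha i).aleph0_le) fun _ => f
  exact ⟨g, fun i => hg ⟨⟩ i trivial⟩

theorem nonempty_cartProd (ha : ∀ i, (a i).IsRegular) : Nonempty (CartProd a) := by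
  obtain ⟨g, -⟩ := exists_lt_pointwise ha Set.univ (ι := PEmpty.{u+1})
    (fun i _ => by simpa using (ha i).pos) PEmpty.elim
  exact ⟨g⟩

theorem exists_bound_ultrafilter (U : Ultrafilter I) {ι : Type u} (h : #ι < ucof a U)
    (F : ι → CartProd a) : ∃ g : CartProd a, ∀ x, ∀ᶠ i in (U : Filter I), F x i < g i := by
  let q : ι → (U : Filter I).Product (Factor a) := fun x => Quotient.mk _ (F x)
  have : ¬ IsCofinal (Set.range q) := fun hc =>
    absurd (Order.cof_le hc) (not_le.2 (Cardinal.mk_range_le.trans_lt h))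
  simp only [IsCofinal, not_forall, not_exists, not_and, Set.forall_mem_range] at this
  obtain ⟨b, hb⟩ := this
  induction b using Quotient.inductionOn with
  | h g =>
    refine ⟨g, fun x => ?_⟩
    have h1 : ¬ ∀ᶠ i in (U : Filter I), g i ≤ F x i := hb x
    rw [← Ultrafilter.eventually_not] at h1
    exact h1.mono fun i hi => not_le.1 hi

theorem ucof_le {U : Ultrafilter I} {ι : Type u} (F : ι → CartProd a)
    (h : ∀ g : CartProd a, ∃ x, ∀ᶠ i in (U : Filter I), g i ≤ F x i) : ucof a U ≤ #ι := by
  let q : ι → (U : Filter I).Product (Factor a) := fun x => Quotient.mk _ (F x)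
  refine (Order.cof_le (s := Set.range q) fun b => ?_).trans Cardinal.mk_range_le
  induction b using Quotient.inductionOn with
  | h g =>
    obtain ⟨x, hx⟩ := h g
    exact ⟨q x, ⟨x, rfl⟩, hx⟩

theorem exists_cofinal_ultrafilter (ha : ∀ i, (a i).IsRegular) {U : Ultrafilter I}
    {c : Cardinal.{u}} (hc : ucof a U = c) :
    ∃ F : c.ord.ToType → CartProd a, ∀ g : CartProd a, ∃ x, ∀ᶠ i in (U : Filter I),
      g i < F x i := by
  obtain ⟨s, hs, hsc⟩ := Order.exists_cof_eq ((U : Filter I).Product (Factor a))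
  have : #c.ord.ToType = #s := by
    rw [hsc, Cardinal.mk_ord_toType]
    exact hc.symm
  obtain ⟨e⟩ := Cardinal.eq.1 this
  choose r hr using fun x : s => Quotient.exists_rep x.1
  refine ⟨fun x => r (e x), fun g => ?_⟩
  obtain ⟨g', hg'⟩ := exists_gt_pointwise ha g
  obtain ⟨y, hy, hle⟩ := hs (Quotient.mk _ g')
  refine ⟨e.symm ⟨y, hy⟩, ?_⟩
  have h1 : ∀ᶠ i in (U : Filter I), g' i ≤ r ⟨y, hy⟩ i := by
    have h2 : Quotient.mk _ (r ⟨y, hy⟩) = y := hr ⟨y, hy⟩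
    generalize r ⟨y, hy⟩ = k at h2
    subst h2
    exact hle
  simp only [Equiv.apply_symm_apply]
  exact h1.mono fun i hi => (hg' i).trans_le hi

theorem lt_ucof (ha : ∀ i, (a i).IsRegular) {U : Ultrafilter I} {c : Cardinal.{u}}
    (h : ∀ᶠ i in (U : Filter I), c < a i) : c < ucof a U := by
  by_contra! hle
  obtain ⟨F, hF⟩ := exists_cofinal_ultrafilter ha (U := U) rfl
  obtain ⟨g, hg⟩ := exists_lt_pointwise ha {i | c < a i}
    (fun i hi => by simpa using hle.trans_lt hi) F
  obtain ⟨x, hx⟩ := hF g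
  obtain ⟨i, hi, hi'⟩ := (hx.and h).exists
  exact lt_asymm hi (hg x i hi')

/-- Joining to each member `F x` of a cofinal family a bound `G x` of the earlier ones makes every
cofinal set of indices yield a cofinal set of functions. -/
theorem ucof_isRegular (ha : ∀ i, (a i).IsRegular) (U : Ultrafilter I) :
    (ucof a U).IsRegular := by
  refine ⟨?_, ?_⟩
  · by_contra! h
    exact lt_irrefl _ (lt_ucof ha (U := U) (Filter.Eventually.of_forall fun i =>
      h.trans_le (ha i).aleph0_le))
  · rw [← Ordinal.cof_toType]
    obtain ⟨F, hF⟩ := exists_cofinal_ultrafilter ha (U := U) rfl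
    rw [Order.le_cof_iff]
    intro s hs
    choose G hG using fun x : (ucof a U).ord.ToType =>
      exists_bound_ultrafilter U (ι := Set.Iio x) (mk_Iio_lt x) fun y => F y
    have h1 : ∀ x y, y ≤ x → ∀ᶠ i in (U : Filter I), F y i ≤ max (F x i) (G x i) := by
      intro x y h
      rcases h.eq_or_lt with rfl | h
      · exact Filter.Eventually.of_forall fun i => le_max_left _ _
      · exact (hG x ⟨y, h⟩).mono fun i hi => hi.le.trans (le_max_right _ _)
    refine ucof_le (ι := s) (fun x i => max (F x i) (G x i)) fun g => ?_
    obtain ⟨x, hx⟩ := hF g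
    obtain ⟨y, hy, hxy⟩ := hs x
    refine ⟨⟨y, hy⟩, ?_⟩
    filter_upwards [hx, h1 y x hxy] with i h2 h3
    exact h2.le.trans h3

theorem ucof_pure (ha : ∀ i, (a i).IsRegular) (i : I) :
    ucof a (pure i : Ultrafilter I) = a i := by
  classical
  refine le_antisymm ?_ ?_
  · obtain ⟨g⟩ := nonempty_cartProd ha
    have := ucof_le (U := (pure i : Ultrafilter I)) (ι := (a i).ord.ToType)
      (fun x => Function.update g i x) fun h => ⟨h i, by simp⟩
    simpa using this
  · by_contra! h
    exact lt_irrefl _ (lt_ucof ha (U := (pure i : Ultrafilter I)) (by simpa using h))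

theorem ucof_map_val (ha : ∀ i, (a i).IsRegular) {b : Set I} (V : Ultrafilter b) :
    ucof a (V.map Subtype.val) = ucof (fun i : b => a i) V := by
  classical
  obtain ⟨d⟩ := nonempty_cartProd ha
  refine le_antisymm ?_ ?_
  · obtain ⟨F, hF⟩ := exists_cofinal_ultrafilter (a := fun i : b => a i) (fun i => ha i)
      (U := V) rfl
    have := ucof_le (U := V.map Subtype.val) (a := a)
      (fun x i => if h : i ∈ b then F x ⟨i, h⟩ else d i) fun g => by
        obtain ⟨x, hx⟩ := hF fun i => g i
        refine ⟨x, ?_⟩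
        change ∀ᶠ i in Filter.map _ _, _
        rw [Filter.eventually_map]
        filter_upwards [hx] with i hi
        simpa using hi.le
    simpa using this
  · obtain ⟨F, hF⟩ := exists_cofinal_ultrafilter ha (U := V.map Subtype.val) rfl
    have := ucof_le (U := V) (a := fun i : b => a i) (fun x i => F x i) fun g => by
      obtain ⟨x, hx⟩ := hF fun i => if h : i ∈ b then g ⟨i, h⟩ else d i
      refine ⟨x, ?_⟩
      change ∀ᶠ i in Filter.map _ _, _ at hx
      rw [Filter.eventually_map] at hx
      filter_upwards [hx] with i hi
      simpa using hi.le
    simpa using this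

/-- Ultrafilters on `b` correspond to ultrafilters on `I` containing `b`, with the same cofinality;
later arguments can stay on `I`. -/
theorem mem_pcfOn (ha : ∀ i, (a i).IsRegular) {b : Set I} {c : Cardinal.{u}} :
    c ∈ pcfOn a b ↔ ∃ U : Ultrafilter I, b ∈ U ∧ ucof a U = c := by
  constructor
  · rintro ⟨V, hV⟩
    exact ⟨V.map Subtype.val, Ultrafilter.mem_map.2 (Filter.mem_of_superset
      (Filter.univ_mem (f := (V : Filter b))) fun x _ => x.2), (ucof_map_val ha V).trans hV⟩
  · rintro ⟨U, hb, hU⟩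
    have hr : Set.range (Subtype.val : b → I) ∈ U := by simpa using hb
    refine ⟨U.comap Subtype.val_injective hr, ?_⟩
    have : (U.comap Subtype.val_injective hr).map Subtype.val = U := by
      apply Ultrafilter.coe_injective
      simp [Filter.map_comap_of_mem hr]
    refine (ucof_map_val ha _).symm.trans ?_
    rw [this, hU]

end

/-! ### Common bounds modulo ultraproducts of large cofinality -/

section

variable {I : Type u} {a : I → Cardinal.{u}}

/-- Induction on the number `θ` of functions. Up to `κ` of them are bounded pointwise on `s`. Beyond
that, the induction hypothesis gives an increasing family dominating them; if `θ` is singular, a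
cofinal subfamily suffices, and if regular, the correction argument applies. -/
theorem exists_bound_on (ha : ∀ i, (a i).IsRegular) {s : Set I} {κ : Cardinal.{u}}
    (hκ : κ.IsRegular) (hI : #I < κ) (hs : ∀ i ∈ s, κ < a i) {c : Cardinal.{u}}
    (θ : Cardinal.{u}) (hθ : θ < c) (ι : Type u) (hι : #ι = θ) (F : ι → CartProd a) :
    ∃ g : CartProd a, ∀ x, ∀ U : Ultrafilter I, c ≤ ucof a U → s ∈ U →
      ∀ᶠ i in (U : Filter I), F x i ≤ g i := by
  induction θ using WellFoundedLT.induction generalizing ι with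
  | ind θ ih =>
  rcases le_or_gt θ κ with hle | hlt
  · obtain ⟨g, hg⟩ := exists_lt_pointwise ha s (ι := ι)
      (fun i hi => (hι.trans_le hle).trans_lt (hs i hi)) F
    exact ⟨g, fun x U _ hU => Filter.mem_of_superset hU fun i hi => (hg x i hi).le⟩
  have hθ0 : ℵ₀ ≤ θ := hκ.aleph0_le.trans hlt.le
  obtain ⟨e⟩ : Nonempty (θ.ord.ToType ≃ ι) := by
    rw [← Cardinal.eq, hι, Cardinal.mk_ord_toType]
  obtain ⟨f, hf⟩ := exists_forall_rel_of_wellFounded (L := θ.ord.ToType) (X := CartProd a)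
    (fun ξ p v => ∀ U : Ultrafilter I, c ≤ ucof a U → s ∈ U →
      (∀ᶠ i in (U : Filter I), F (e ξ) i ≤ v i) ∧
        ∀ η, ∀ᶠ i in (U : Filter I), p η i ≤ v i) (fun ξ p => by
      have hlt := mk_Iio_lt ξ
      obtain ⟨g, hg⟩ := ih _ hlt (hlt.trans hθ) _ rfl p
      refine ⟨fun i => max (F (e ξ) i) (g i), fun U hU hsU => ⟨?_, fun η => ?_⟩⟩
      · exact Filter.Eventually.of_forall fun i => le_max_left _ _
      · exact (hg η U hU hsU).mono fun i hi => hi.trans (le_max_right _ _))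
  have hmono : ∀ ξ η, η ≤ ξ → ∀ U : Ultrafilter I, c ≤ ucof a U → s ∈ U →
      ∀ᶠ i in (U : Filter I), f η i ≤ f ξ i := by
    intro ξ η h U hU hsU
    rcases h.eq_or_lt with rfl | h
    · exact Filter.Eventually.of_forall fun i => le_rfl
    · exact (hf ξ U hU hsU).2 ⟨η, h⟩
  suffices h : ∃ g : CartProd a, ∀ ξ, ∀ U : Ultrafilter I, c ≤ ucof a U → s ∈ U →
      ∀ᶠ i in (U : Filter I), f ξ i ≤ g i by
    obtain ⟨g, hg⟩ := h
    refine ⟨g, fun x U hU hsU => ?_⟩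
    have h1 := (hf (e.symm x) U hU hsU).1
    simp only [Equiv.apply_symm_apply] at h1
    filter_upwards [h1, hg (e.symm x) U hU hsU] with i h2 h3
    exact h2.trans h3
  by_cases hreg : θ ≤ θ.ord.cof
  swap
  · obtain ⟨t, ht, htc⟩ := Order.exists_cof_eq θ.ord.ToType
    rw [Ordinal.cof_toType] at htc
    have hlt : #t < θ := htc.trans_lt (not_le.1 hreg)
    obtain ⟨g, hg⟩ := ih _ hlt (hlt.trans hθ) t rfl fun x => f x
    refine ⟨g, fun ξ U hU hsU => ?_⟩
    obtain ⟨η, hη, hle⟩ := ht ξ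
    filter_upwards [hmono η ξ hle U hU hsU, hg ⟨η, hη⟩ U hU hsU] with i h1 h2
    exact h1.trans h2
  by_contra! hcon
  have hreg' : θ.IsRegular := ⟨hθ0, hreg⟩
  have step : ∀ g : CartProd a, ∃ (U : Ultrafilter I) (ξ : θ.ord.ToType) (h : CartProd a),
      c ≤ ucof a U ∧ s ∈ U ∧ (∀ᶠ i in (U : Filter I), g i < f ξ i) ∧
      ∀ ξ, ∀ᶠ i in (U : Filter I), f ξ i ≤ h i := by
    intro g
    obtain ⟨ξ, U, hU, hsU, hξ⟩ := hcon g
    obtain ⟨h, hh⟩ := exists_bound_ultrafilter U (by simpa using hθ.trans_le hU) f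
    exact ⟨U, ξ, h, hU, hsU, hξ, fun ξ => (hh ξ).mono fun i hi => hi.le⟩
  choose V ζ h hV hsV hζ hh using step
  have : Nonempty (CartProd a) := nonempty_cartProd ha
  -- A bound `g` that fails at `V g` is corrected by `h g`, which bounds the whole family modulo `V
  -- g`.
  obtain ⟨p, hp⟩ := exists_iterate (W := κ.ord.ToType) (fun g g' : CartProd a => ∀ i ∈ s, g i ≤ g' i)
    (fun p => by
      obtain ⟨g, hg⟩ := exists_lt_pointwise ha s (ι := κ.ord.ToType) (by simpa using hs) p
      exact ⟨g, fun w i hi => (hg w i hi).le⟩) (fun g i => max (g i) (h g i))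
  obtain ⟨ξ, hξ⟩ := exists_forall_lt hreg' (ι := κ.ord.ToType) (by simpa using hlt)
    fun w => ζ (p w)
  have := noMaxOrder_toType hκ.aleph0_le
  -- The set of stage `v` is in `V (p v)`, but modulo that ultrafilter `f ξ ≤ h (p v) ≤ p w`, so it
  -- cannot lie in the set of stage `w`.
  obtain ⟨v, w, hvw, hsub⟩ := exists_lt_subset_of_antitone (W := κ.ord.ToType) (by simpa using hI)
    (fun w => {i | i ∈ s ∧ p w i < f ξ i}) (fun v w hvw i hi => by
      rcases hvw.eq_or_lt with rfl | hvw
      · exact hi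
      · exact ⟨hi.1, ((le_max_left _ _).trans (hp v w hvw i hi.1)).trans_lt hi.2⟩)
  have h1 : ∀ᶠ i in (V (p v) : Filter I), p v i < f ξ i := by
    filter_upwards [hζ (p v), hmono ξ _ (hξ v).le _ (hV _) (hsV _)] with i h1 h2
    exact h1.trans_le h2
  have h2 : ∀ᶠ i in (V (p v) : Filter I), i ∈ s := hsV _
  obtain ⟨i, hi, his, hi'⟩ := (h1.and (h2.and (hh (p v) ξ))).exists
  exact absurd (hsub ⟨his, hi⟩).2 (not_lt.2 (hi'.trans
    ((le_max_right _ _).trans (hp v w hvw i his))))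

theorem mem_or_eq_pure {s : Set I} (hs : sᶜ.Finite) (U : Ultrafilter I) :
    s ∈ U ∨ ∃ i ∈ sᶜ, U = pure i := by
  rcases U.mem_or_compl_mem s with h | h
  · exact .inl h
  · exact .inr (Ultrafilter.eq_pure_of_finite_mem hs h)

/-- Fewer than `c` elements of `∏ a` have a common upper bound modulo all the ultrafilters whose
ultraproduct has cofinality at least `c`. -/
theorem exists_bound (ha : ∀ i, (a i).IsRegular) {s : Set I} {κ : Cardinal.{u}}
    (hκ : κ.IsRegular) (hI : #I < κ) (hs : ∀ i ∈ s, κ < a i) (hfin : sᶜ.Finite)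
    {c : Cardinal.{u}} {ι : Type u} (hι : #ι < c) (F : ι → CartProd a) :
    ∃ g : CartProd a, ∀ x, ∀ U : Ultrafilter I, c ≤ ucof a U →
      ∀ᶠ i in (U : Filter I), F x i < g i := by
  classical
  obtain ⟨g, hg⟩ := exists_bound_on ha hκ hI hs _ hι ι rfl F
  obtain ⟨h, hh⟩ := exists_lt_pointwise ha {i | #ι < a i} (fun i hi => hi) F
  obtain ⟨k, hk⟩ := exists_gt_pointwise ha fun i => max (g i) (h i)
  refine ⟨k, fun x U hU => ?_⟩
  rcases mem_or_eq_pure hfin U with hsU | ⟨i, -, rfl⟩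
  · filter_upwards [hg x U hU hsU] with i hi
    exact (hi.trans (le_max_left _ _)).trans_lt (hk i)
  · rw [ucof_pure ha] at hU
    have := hh x i (hι.trans_le hU)
    simpa using (this.trans_le (le_max_right _ _)).trans (hk i)

end

/-! ### Universal sequences -/

section

variable {I : Type u} {a : I → Cardinal.{u}}

/-- All but finitely many members of the family `a` of regular cardinals, namely those with index
in `s`, are much larger than the regular cardinal `κ`, which is larger than the index set. -/
structure IsProgressive (a : I → Cardinal.{u}) (s : Set I) (κ : Cardinal.{u}) : Prop where
  isRegular : ∀ i, (a i).IsRegular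
  injective : Function.Injective a
  isRegular_base : κ.IsRegular
  card_lt : #I < κ
  lt : ∀ i ∈ s, Order.succ (Order.succ κ) < a i
  finite_compl : sᶜ.Finite

namespace IsProgressive

variable {s : Set I} {κ c : Cardinal.{u}}

theorem base_lt (H : IsProgressive a s κ) : ∀ i ∈ s, κ < a i := fun i hi =>
  ((Order.lt_succ κ).trans (Order.lt_succ _)).trans (H.lt i hi)

theorem exists_bound (H : IsProgressive a s κ) {ι : Type u} (hι : #ι < c) (F : ι → CartProd a) :
    ∃ g : CartProd a, ∀ x, ∀ U : Ultrafilter I, c ≤ ucof a U →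
      ∀ᶠ i in (U : Filter I), F x i < g i :=
  PCF.exists_bound H.isRegular H.isRegular_base H.card_lt H.base_lt H.finite_compl hι F

end IsProgressive

/-- The sequence `f` is strictly increasing modulo the sets on which all ultraproducts have
cofinality less than `c`. -/
def IsIncreasing (a : I → Cardinal.{u}) (c : Cardinal.{u}) (f : c.ord.ToType → CartProd a) : Prop :=
  ∀ ξ η, η < ξ → ∀ U : Ultrafilter I, c ≤ ucof a U → ∀ᶠ i in (U : Filter I), f η i < f ξ i

/-- The sequence `f` is cofinal in all the ultraproducts that have cofinality `c`. -/
def IsUniversal (a : I → Cardinal.{u}) (c : Cardinal.{u}) (f : c.ord.ToType → CartProd a) : Prop :=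
  ∀ U : Ultrafilter I, ucof a U = c → ∀ g : CartProd a, ∃ ξ, ∀ᶠ i in (U : Filter I), g i < f ξ i

theorem IsIncreasing.eventually_le {c : Cardinal.{u}} {f : c.ord.ToType → CartProd a}
    (hf : IsIncreasing a c f) {ξ η : c.ord.ToType} (h : η ≤ ξ) {U : Ultrafilter I}
    (hU : c ≤ ucof a U) : ∀ᶠ i in (U : Filter I), f η i ≤ f ξ i := by
  rcases h.eq_or_lt with rfl | h
  · exact Filter.Eventually.of_forall fun i => le_rfl
  · exact (hf _ _ h U hU).mono fun i hi => hi.le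

namespace IsProgressive

variable {s : Set I} {κ c : Cardinal.{u}}

/-- The last clause holds pointwise on `s`, not just modulo ultrafilters, because the members there
exceed `#M`; club guessing will rely on it. -/
theorem exists_increasing (H : IsProgressive a s κ) (G : c.ord.ToType → CartProd a) {M : Type u}
    (hM : ∀ i ∈ s, #M < a i) (d : c.ord.ToType → M → c.ord.ToType) :
    ∃ f : c.ord.ToType → CartProd a, IsIncreasing a c f ∧ (∀ ξ i, G ξ i ≤ f ξ i) ∧
      ∀ ξ m, d ξ m < ξ → ∀ i ∈ s, f (d ξ m) i ≤ f ξ i := by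
  obtain ⟨f, hf⟩ := exists_forall_rel_of_wellFounded (L := c.ord.ToType) (X := CartProd a)
    (fun ξ p v => (∀ η, ∀ U : Ultrafilter I, c ≤ ucof a U → ∀ᶠ i in (U : Filter I), p η i < v i) ∧
      (∀ i, G ξ i ≤ v i) ∧ ∀ m (h : d ξ m < ξ), ∀ i ∈ s, p ⟨d ξ m, h⟩ i ≤ v i) (fun ξ p => by
      obtain ⟨g, hg⟩ := H.exists_bound (mk_Iio_lt ξ) p
      classical
      obtain ⟨h, hh⟩ := exists_lt_pointwise H.isRegular s hM
        fun m => if h : d ξ m < ξ then p ⟨d ξ m, h⟩ else g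
      refine ⟨fun i => max (max (g i) (h i)) (G ξ i), fun η U hU => ?_, fun i => le_max_right _ _,
        fun m hm i hi => ?_⟩
      · filter_upwards [hg η U hU] with i hi
        exact hi.trans_le ((le_max_left _ _).trans (le_max_left _ _))
      · have := hh m i hi
        rw [dif_pos hm] at this
        exact this.le.trans ((le_max_right _ _).trans (le_max_left _ _)))
  exact ⟨f, fun ξ η h => (hf ξ).1 ⟨η, h⟩, fun ξ => (hf ξ).2.1, fun ξ m h => (hf ξ).2.2 m h⟩

/-- If `F` fails, some increasing `f F` above it is bounded by `g F` in an ultraproduct of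
cofinality `c`. The correction adds a cofinal sequence `D F` of that ultraproduct. -/
theorem exists_universal_bound_on (H : IsProgressive a s κ) (c : Cardinal.{u}) :
    ∃ F : c.ord.ToType → CartProd a, ∀ f, IsIncreasing a c f →
      (∀ ξ, ∀ i ∈ s, F ξ i ≤ f ξ i) → ∀ U : Ultrafilter I, s ∈ U → ucof a U = c →
        ∀ g : CartProd a, ∃ ξ, ∀ᶠ i in (U : Filter I), g i < f ξ i := by
  by_contra! hcon
  choose f hf hFf U hsU hU g hg using hcon
  choose D hD using fun F => exists_cofinal_ultrafilter H.isRegular (hU F)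
  have hne : Nonempty (CartProd a) := nonempty_cartProd H.isRegular
  have hreg : c.IsRegular := by
    rw [← hU fun _ => Classical.arbitrary _]
    exact ucof_isRegular H.isRegular _
  have hκc : κ < c := by
    rw [← hU fun _ => Classical.arbitrary _]
    exact lt_ucof H.isRegular (Filter.mem_of_superset (hsU _) H.base_lt)
  obtain ⟨p, hp⟩ := exists_iterate (W := κ.ord.ToType) (P := c.ord.ToType → CartProd a)
    (fun F F' => ∀ ξ, ∀ i ∈ s, F ξ i ≤ F' ξ i)
    (fun p => by
      choose F hF using fun ξ => exists_lt_pointwise H.isRegular s (ι := κ.ord.ToType)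
        (by simpa using H.base_lt) fun w => p w ξ
      exact ⟨F, fun w ξ i hi => (hF ξ w i hi).le⟩) (fun F ξ i => max (f F ξ i) (D F ξ i))
  obtain ⟨h, hh⟩ := exists_lt_pointwise H.isRegular s (ι := κ.ord.ToType)
    (by simpa using H.base_lt) fun w => g (p w)
  choose ζ hζ using fun w => hD (p w) h
  obtain ⟨ξ, hξ⟩ := exists_forall_lt hreg (ι := κ.ord.ToType) (by simpa using hκc) ζ
  have := noMaxOrder_toType H.isRegular_base.aleph0_le
  -- Modulo `U (p v)`, the term at `ξ` is below `h` in round `v`, but above `h` in round `w`, which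
  -- has absorbed `D (p v)`.
  obtain ⟨v, w, hvw, hsub⟩ := exists_lt_subset_of_antitone (W := κ.ord.ToType)
    (by simpa using H.card_lt)
    (fun w => {i | i ∈ s ∧ f (p w) ξ i ≤ h i}) (fun v w hvw i hi => by
      rcases hvw.eq_or_lt with rfl | hvw
      · exact hi
      · exact ⟨hi.1, ((hFf _ ξ i hi.1).trans' ((le_max_left _ _).trans
          (hp v w hvw ξ i hi.1))).trans hi.2⟩)
  have h2 : ∀ᶠ i in (U (p v) : Filter I), i ∈ s := hsU _
  obtain ⟨i, hi1, hi2, hi3, hi4⟩ := ((hg (p v) ξ).and (h2.and ((hζ v).and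
    (hf (p w) _ _ (hξ v) (U (p v)) (hU _).ge)))).exists
  have h3 := (hsub ⟨hi2, hi1.trans (hh v i hi2).le⟩).2
  have h4 := (le_max_right _ _).trans (hp v w hvw (ζ v) i hi2)
  exact absurd (hi3.trans_le (h4.trans (hFf _ _ i hi2))) (not_lt.2 (hi4.le.trans h3))

/-- An ultrafilter of cofinality `c` that omits `s` is principal, at an index with `a i = c`.
Injectivity makes that index unique, so one further sequence `G` takes care of it. -/
theorem exists_universal (H : IsProgressive a s κ) (c : Cardinal.{u}) {M : Type u}
    (hM : ∀ i ∈ s, #M < a i) (d : c.ord.ToType → M → c.ord.ToType) :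
    ∃ f : c.ord.ToType → CartProd a, IsIncreasing a c f ∧ IsUniversal a c f ∧
      ∀ ξ m, d ξ m < ξ → ∀ i ∈ s, f (d ξ m) i ≤ f ξ i := by
  obtain ⟨F, hF⟩ := H.exists_universal_bound_on c
  have : ∃ G : c.ord.ToType → CartProd a, ∀ i, a i = c → ∀ g : CartProd a,
      ∃ ξ, ∀ᶠ j in ((pure i : Ultrafilter I) : Filter I), g j < G ξ j := by
    by_cases h : ∃ i, a i = c
    · obtain ⟨i, hi⟩ := h
      obtain ⟨G, hG⟩ := exists_cofinal_ultrafilter H.isRegular (U := pure i)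
        ((ucof_pure H.isRegular i).trans hi)
      refine ⟨G, fun j hj => ?_⟩
      rw [H.injective (hj.trans hi.symm)]
      exact hG
    · exact ⟨F, fun i hi => absurd ⟨i, hi⟩ h⟩
  obtain ⟨G, hG⟩ := this
  obtain ⟨f, hf, hGf, hfd⟩ := H.exists_increasing (fun ξ i => max (F ξ i) (G ξ i)) hM d
  refine ⟨f, hf, fun U hU g => ?_, hfd⟩
  rcases mem_or_eq_pure H.finite_compl U with hsU | ⟨i, -, rfl⟩
  · exact hF f hf (fun ξ i _ => (le_max_left _ _).trans (hGf ξ i)) U hsU hU g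
  · rw [ucof_pure H.isRegular] at hU
    obtain ⟨ξ, hξ⟩ := hG i hU g
    exact ⟨ξ, hξ.mono fun j hj => hj.trans_le ((le_max_right _ _).trans (hGf ξ j))⟩

end IsProgressive

end

section

/-! ### Closure points and club guessing -/

theorem exists_isLUB_of_bddAbove {M : Type u} [LinearOrder M] [WellFoundedLT M] {s : Set M}
    (h : BddAbove s) : ∃ b, IsLUB s b := by
  have h' : (upperBounds s).Nonempty := h
  exact ⟨wellFounded_lt.min _ h', wellFounded_lt.min_mem _ h', fun x hx =>
    wellFounded_lt.min_le hx⟩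

/-- The closure points of the function `φ`. -/
def closurePoints {M : Type u} [LT M] (φ : M → M) : Set M :=
  {j | ∀ k, k < j → φ k < j}

section ClosurePoints

variable {M : Type u} [LinearOrder M]

theorem closurePoints_anti {φ ψ : M → M} (h : ∀ k, φ k ≤ ψ k) :
    closurePoints ψ ⊆ closurePoints φ := fun _ hj k hk => (h k).trans_lt (hj k hk)

theorem isLUB_mem_closurePoints {φ : M → M} {s : Set M} (hs : s ⊆ closurePoints φ) {b : M}
    (hb : IsLUB s b) : b ∈ closurePoints φ := fun k hk => by
  obtain ⟨e, he, hke⟩ := (lt_isLUB_iff hb).1 hk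
  exact (hs he k hke).trans_le (hb.1 he)

theorem exists_last_closurePoint [WellFoundedLT M] (φ : M → M) (γ : M) :
    ∃ b ∈ closurePoints φ, b ≤ γ ∧ ∀ e ∈ closurePoints φ, e ≤ γ → e ≤ b := by
  obtain ⟨b, hb⟩ := exists_isLUB_of_bddAbove (s := {e | e ∈ closurePoints φ ∧ e ≤ γ})
    ⟨γ, fun e he => he.2⟩
  exact ⟨b, isLUB_mem_closurePoints (fun e he => he.1) hb, hb.2 fun e he => he.2,
    fun e he h => hb.1 ⟨he, h⟩⟩

end ClosurePoints

theorem exists_lt_closurePoint {μ : Cardinal.{u}} (hμ : μ.IsRegular) (hμ0 : ℵ₀ < μ)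
    (φ : μ.ord.ToType → μ.ord.ToType) (γ : μ.ord.ToType) : ∃ e ∈ closurePoints φ, γ < e := by
  have step : ∀ m, ∃ n, ∀ k : Set.Iic m, max m (φ k) < n := fun m =>
    exists_forall_lt hμ (ι := Set.Iic m) (mk_Iic_lt hμ.aleph0_le m) fun k => max m (φ k)
  choose N hN using step
  let x : ℕ → μ.ord.ToType := fun n => N^[n] γ
  have hx : ∀ n, ∀ k ≤ x n, max (x n) (φ k) < x (n + 1) := fun n k hk => by
    simp only [x, Function.iterate_succ_apply']
    exact hN _ ⟨k, hk⟩
  obtain ⟨b, hb⟩ := exists_forall_lt hμ (ι := ULift.{u} ℕ) (by simpa using hμ0) fun n => x n.down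
  obtain ⟨e, he⟩ := exists_isLUB_of_bddAbove (s := Set.range x)
    ⟨b, Set.forall_mem_range.2 fun n => (hb ⟨n⟩).le⟩
  refine ⟨e, fun k hk => ?_, ?_⟩
  · obtain ⟨_, ⟨n, rfl⟩, hn⟩ := (lt_isLUB_iff he).1 hk
    exact ((le_max_right _ _).trans_lt (hx n k hn.le)).trans_le (he.1 ⟨n + 1, rfl⟩)
  · exact ((le_max_left _ _).trans_lt (hx 0 γ le_rfl)).trans_le (he.1 ⟨1, rfl⟩)

/-- `α` is the supremum of an increasing `κ`-sequence of closure points; the clauses about `t`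
express that it has cofinality `κ`. -/
theorem exists_limit_closurePoints {κ μ : Cardinal.{u}} (hκ : κ.IsRegular) (hμ : μ.IsRegular)
    (hκμ : κ < μ) (φ : μ.ord.ToType → μ.ord.ToType) :
    ∃ α, (∀ γ < α, ∃ e ∈ closurePoints φ, γ < e ∧ e < α) ∧
      (∃ t ⊆ Set.Iio α, (∀ γ < α, ∃ e ∈ t, γ ≤ e) ∧ #t ≤ κ) ∧
      ∀ t ⊆ Set.Iio α, (∀ γ < α, ∃ e ∈ t, γ ≤ e) → κ ≤ #t := by
  choose n hn hlt using exists_lt_closurePoint hμ (hκ.aleph0_le.trans_lt hκμ) φ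
  have : Nonempty μ.ord.ToType := by
    rw [Ordinal.nonempty_toType_iff]
    simpa using hμ.pos.ne'
  have hbd : ∀ p : κ.ord.ToType → μ.ord.ToType, ∃ q, ∀ w, p w < q := fun p =>
    exists_forall_lt hμ (ι := κ.ord.ToType) (by simpa using hκμ) p
  obtain ⟨p, hp⟩ := exists_iterate (W := κ.ord.ToType) (P := μ.ord.ToType) (· ≤ ·)
    (fun p => (hbd p).imp fun q hq w => (hq w).le) n
  obtain ⟨b, hb⟩ := hbd fun w => n (p w)
  obtain ⟨α, hα⟩ := exists_isLUB_of_bddAbove (s := Set.range fun w => n (p w))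
    ⟨b, Set.forall_mem_range.2 fun w => (hb w).le⟩
  have := noMaxOrder_toType hκ.aleph0_le
  have hnlt : ∀ w, n (p w) < α := fun w => by
    obtain ⟨w', hw'⟩ := exists_gt w
    exact ((hp _ _ hw').trans_lt (hlt _)).trans_le (hα.1 ⟨w', rfl⟩)
  have hcof : ∀ γ < α, ∃ w, γ < n (p w) := fun γ hγ => by
    obtain ⟨_, ⟨w, rfl⟩, hw⟩ := (lt_isLUB_iff hα).1 hγ
    exact ⟨w, hw⟩
  refine ⟨α, fun γ hγ => ?_, ⟨Set.range fun w => n (p w), ?_, fun γ hγ => ?_, ?_⟩,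
    fun t ht htc => ?_⟩
  · obtain ⟨w, hw⟩ := hcof γ hγ
    exact ⟨_, hn _, hw, hnlt w⟩
  · exact Set.range_subset_iff.2 hnlt
  · obtain ⟨w, hw⟩ := hcof γ hγ
    exact ⟨_, ⟨w, rfl⟩, hw.le⟩
  · simpa using Cardinal.mk_range_le (f := fun w : κ.ord.ToType => n (p w))
  · by_contra! hlt'
    choose v hv using fun y : t => hcof y (ht y.2)
    obtain ⟨w, hw⟩ := exists_forall_lt hκ hlt' v
    obtain ⟨y, hy, hle⟩ := htc _ (hnlt w)
    exact lt_irrefl _ ((hle.trans_lt (hv ⟨y, hy⟩)).trans_le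
      ((hp _ _ (hw ⟨y, hy⟩)).trans (hlt _).le))

/-- Club guessing at `κ⁺⁺` for cofinality `κ`. -/
theorem exists_club_guessing {κ : Cardinal.{u}} (hκ : κ.IsRegular) :
    ∃ T : (Order.succ (Order.succ κ)).ord.ToType → Set (Order.succ (Order.succ κ)).ord.ToType,
      ∀ φ : (Order.succ (Order.succ κ)).ord.ToType → (Order.succ (Order.succ κ)).ord.ToType,
        ∃ α, κ ≤ #(T α) ∧ (∀ j ∈ T α, ∃ j' ∈ T α, j < j') ∧
          T α ⊆ closurePoints φ := by
  set ν := Order.succ κ with hν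
  have hνreg : ν.IsRegular := Cardinal.isRegular_succ hκ.aleph0_le
  set μ := Order.succ ν with hμ
  have hμreg : μ.IsRegular := Cardinal.isRegular_succ hνreg.aleph0_le
  have hκν : κ < ν := Order.lt_succ κ
  have hνμ : ν < μ := Order.lt_succ ν
  have hc : ∀ α : μ.ord.ToType, ∃ c : Set μ.ord.ToType,
      (∃ t ⊆ Set.Iio α, (∀ γ < α, ∃ e ∈ t, γ ≤ e) ∧ #t ≤ κ) →
      c ⊆ Set.Iio α ∧ (∀ γ < α, ∃ e ∈ c, γ ≤ e) ∧ #c ≤ κ := fun α => by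
    by_cases h : ∃ t ⊆ Set.Iio α, (∀ γ < α, ∃ e ∈ t, γ ≤ e) ∧ #t ≤ κ
    · obtain ⟨t, ht⟩ := h
      exact ⟨t, fun _ => ht⟩
    · exact ⟨∅, fun h' => absurd h' h⟩
  choose c hc using hc
  -- `r φ γ` is the last closure point of `φ` up to `γ`. The guess tried with `φ` is the image under
  -- `r φ` of a short cofinal set `c α`; if it misses the closure points of `ψ φ`, then `φ` is
  -- enlarged by `ψ φ`.
  choose r hrmem hrle hr using exists_last_closurePoint (M := μ.ord.ToType)
  by_contra! hcon
  choose ψ hψ using fun φ => hcon fun α => {j | ∃ γ ∈ c α, j = r φ γ}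
  have hbd : ∀ p : ν.ord.ToType → μ.ord.ToType → μ.ord.ToType, ∃ q : μ.ord.ToType → μ.ord.ToType,
      ∀ w k, p w k ≤ q k := by
    intro p
    choose q hq using fun k => exists_forall_lt hμreg (ι := ν.ord.ToType) (by simpa using hνμ)
      fun w => p w k
    exact ⟨q, fun w k => (hq k w).le⟩
  have : Nonempty (μ.ord.ToType → μ.ord.ToType) := ⟨id⟩
  obtain ⟨p, hp⟩ := exists_iterate (W := ν.ord.ToType) (P := μ.ord.ToType → μ.ord.ToType)
    (fun φ ψ => ∀ k, φ k ≤ ψ k) hbd (fun φ k => max (φ k) (ψ φ k))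
  obtain ⟨q, hq⟩ := hbd p
  obtain ⟨α, hlim, hsmall, hlarge⟩ := exists_limit_closurePoints hκ hμreg (hκν.trans hνμ) q
  obtain ⟨hcα, hcof, hcard⟩ := hc α hsmall
  have hanti : ∀ γ v w, v ≤ w → r (p w) γ ≤ r (p v) γ := fun γ v w hvw => by
    rcases hvw.eq_or_lt with rfl | hvw
    · exact le_rfl
    · exact hr _ _ _ (closurePoints_anti (fun k => (le_max_left _ _).trans (hp v w hvw k))
        (hrmem _ _)) (hrle _ _)
  -- Enlarging `φ` only lowers `r φ γ`, which therefore stabilizes; the at most `κ` points of `c α`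
  -- do so by one stage below `ν`.
  have hstab : ∀ γ, ∃ v, ∀ w, v ≤ w → r (p v) γ = r (p w) γ := fun γ => by
    have hne : (Set.range fun v => r (p v) γ).Nonempty := by
      have : Nonempty ν.ord.ToType := by
        rw [Ordinal.nonempty_toType_iff]
        simpa using hνreg.pos.ne'
      exact Set.range_nonempty _
    obtain ⟨v, hv⟩ := wellFounded_lt.min_mem _ hne
    refine ⟨v, fun w hw => le_antisymm ?_ (hanti γ v w hw)⟩
    simp only at hv
    rw [hv]
    exact wellFounded_lt.min_le (Set.mem_range_self w)
  choose b hb using hstab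
  obtain ⟨v, hv⟩ := exists_forall_lt hνreg (ι := c α) (hcard.trans_lt hκν) fun γ => b γ
  have := noMaxOrder_toType hνreg.aleph0_le
  obtain ⟨w, hvw⟩ := exists_gt v
  have heq : ∀ γ ∈ c α, r (p v) γ = r (p w) γ := fun γ hγ =>
    (hb γ v (hv ⟨γ, hγ⟩).le).symm.trans (hb γ w ((hv ⟨γ, hγ⟩).trans hvw).le)
  have hTcof : ∀ γ < α, ∃ j, (∃ γ ∈ c α, j = r (p v) γ) ∧ γ < j := by
    intro γ hγ
    obtain ⟨e, he, hγe, heα⟩ := hlim γ hγ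
    obtain ⟨γ', hγ', hle⟩ := hcof e heα
    have : e ≤ r (p v) γ' := hr _ _ _ (closurePoints_anti (hq v) he) hle
    exact ⟨_, ⟨γ', hγ', rfl⟩, hγe.trans_le this⟩
  have hTlt : ∀ j, (∃ γ ∈ c α, j = r (p v) γ) → j < α := by
    rintro j ⟨γ, hγ, rfl⟩
    exact (hrle _ _).trans_lt (hcα hγ)
  refine hψ (p v) α (hlarge _ hTlt fun γ hγ => (hTcof γ hγ).imp fun j hj => ⟨hj.1, hj.2.le⟩)
    (fun j hj => hTcof j (hTlt j hj)) ?_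
  rintro j ⟨γ, hγ, rfl⟩
  rw [heq γ hγ]
  exact closurePoints_anti (fun k => (le_max_right _ _).trans (hp v w hvw k)) (hrmem _ _)

end

/-! ### Normal sequences, stabilization and generators -/

section

/-- A strictly increasing sequence that is continuous at limits. -/
structure IsNormalSeq {M L : Type u} [LinearOrder M] [LinearOrder L] (x : M → L) : Prop where
  strictMono : StrictMono x
  isLUB : ∀ j, (∀ k < j, ∃ l, k < l ∧ l < j) → IsLUB (x '' Set.Iio j) (x j)

theorem IsNormalSeq.lt_of_isLUB {M L : Type u} [LinearOrder M] [LinearOrder L] [NoMaxOrder M]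
    {x : M → L} (hx : IsNormalSeq x) {δ : L} (hδ : IsLUB (Set.range x) δ) (j : M) : x j < δ := by
  obtain ⟨k, hk⟩ := exists_gt j
  exact (hx.strictMono hk).trans_le (hδ.1 ⟨k, rfl⟩)

/-- Two normal sequences with the same supremum agree at the closure points of some function. -/
theorem IsNormalSeq.exists_closurePoints_eq {M L : Type u} [LinearOrder M] [LinearOrder L]
    [NoMaxOrder M] {x y : M → L} (hx : IsNormalSeq x) (hy : IsNormalSeq y) {δ : L}
    (hxδ : IsLUB (Set.range x) δ) (hyδ : IsLUB (Set.range y) δ) :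
    ∃ φ : M → M, (∀ k, k < φ k) ∧ ∀ j ∈ closurePoints φ, x j = y j := by
  have : ∀ k, ∃ l, k < l ∧ x k < y l ∧ y k < x l := fun k => by
    obtain ⟨_, ⟨l, rfl⟩, hl⟩ := (lt_isLUB_iff hyδ).1 (hx.lt_of_isLUB hxδ k)
    obtain ⟨_, ⟨m, rfl⟩, hm⟩ := (lt_isLUB_iff hxδ).1 (hy.lt_of_isLUB hyδ k)
    obtain ⟨n, hn⟩ := exists_gt (max k (max l m))
    simp only [max_lt_iff] at hn
    exact ⟨n, hn.1, hl.trans (hy.strictMono hn.2.1), hm.trans (hx.strictMono hn.2.2)⟩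
  choose φ hφ hxy hyx using this
  refine ⟨φ, hφ, fun j hj => ?_⟩
  have hlim : ∀ k < j, ∃ l, k < l ∧ l < j := fun k hk => ⟨φ k, hφ k, hj k hk⟩
  refine le_antisymm ((hx.isLUB j hlim).2 ?_) ((hy.isLUB j hlim).2 ?_)
  · rintro _ ⟨k, hk, rfl⟩
    exact ((hxy k).trans (hy.strictMono (hj k hk))).le
  · rintro _ ⟨k, hk, rfl⟩
    exact ((hyx k).trans (hx.strictMono (hj k hk))).le

/-- At limits the term is forced to be the supremum, so the demand `N` can be met only elsewhere. -/
theorem exists_normalSeq {c : Cardinal.{u}} (hc : c.IsRegular) {M : Type u} [LinearOrder M]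
    [WellFoundedLT M] (hM : #M < c)
    (N : (j : M) → (Set.Iio j → c.ord.ToType) → c.ord.ToType) :
    ∃ x : M → c.ord.ToType, IsNormalSeq x ∧
      ∀ j, (¬ ∀ k < j, ∃ l, k < l ∧ l < j) → N j (fun k => x k) ≤ x j := by
  obtain ⟨x, hx⟩ := exists_forall_rel_of_wellFounded (L := M) (X := c.ord.ToType)
    (fun j p v => ((∀ k < j, ∃ l, k < l ∧ l < j) → IsLUB (Set.range p) v) ∧
      ((¬ ∀ k < j, ∃ l, k < l ∧ l < j) → (∀ k, p k < v) ∧ N j p ≤ v)) (fun j p => by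
      obtain ⟨b, hb⟩ := exists_forall_lt hc ((Cardinal.mk_set_le (Set.Iio j)).trans_lt hM) p
      by_cases hj : ∀ k < j, ∃ l, k < l ∧ l < j
      · obtain ⟨v, hv⟩ := exists_isLUB_of_bddAbove (s := Set.range p)
          ⟨b, Set.forall_mem_range.2 fun k => (hb k).le⟩
        exact ⟨v, fun _ => hv, fun h => absurd hj h⟩
      · exact ⟨max b (N j p), fun h => absurd h hj, fun _ =>
          ⟨fun k => (hb k).trans_le (le_max_left _ _), le_max_right _ _⟩⟩)
  have hrange : ∀ j, (Set.range fun k : Set.Iio j => x k) = x '' Set.Iio j := fun j => by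
    ext; simp
  refine ⟨x, ⟨?_, fun j hj => hrange j ▸ (hx j).1 hj⟩, fun j hj => ((hx j).2 hj).2⟩
  have : ∀ j, ∀ k < j, x k < x j := fun j => by
    induction j using WellFoundedLT.induction with
    | ind j ih =>
    intro k hk
    by_cases hj : ∀ k < j, ∃ l, k < l ∧ l < j
    · obtain ⟨l, hkl, hlj⟩ := hj k hk
      exact (ih l hlj k hkl).trans_le (((hx j).1 hj).1 ⟨⟨l, hlj⟩, rfl⟩)
    · exact ((hx j).2 hj).1 ⟨k, hk⟩
  exact fun k j h => this j k h

variable {I : Type u} {a : I → Cardinal.{u}} {s : Set I} {κ c : Cardinal.{u}}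

namespace IsProgressive

/-- Otherwise, modulo some `V ξ`, the function `g` is above `f ξ` and below a later term. A normal
sequence `x` runs through such jumps up to `δ`. It agrees with `d δ` on a club, so the terms at a
guessed set `T α` lie below `f δ` everywhere on `s`; jumps between them then give `κ` distinct
points of `I`. -/
theorem exists_stable (H : IsProgressive a s κ) (hc : c.IsRegular)
    (hμc : Order.succ (Order.succ κ) < c) {f : c.ord.ToType → CartProd a}
    (hf : IsIncreasing a c f)
    (d : c.ord.ToType → (Order.succ (Order.succ κ)).ord.ToType → c.ord.ToType)
    (hd : ∀ δ (x : (Order.succ (Order.succ κ)).ord.ToType → c.ord.ToType), IsNormalSeq x →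
      IsLUB (Set.range x) δ → IsNormalSeq (d δ) ∧ IsLUB (Set.range (d δ)) δ)
    (hfd : ∀ ξ m, d ξ m < ξ → ∀ i ∈ s, f (d ξ m) i ≤ f ξ i) (g : CartProd a) :
    ∃ ξ, ∀ ζ, ξ ≤ ζ → ∀ U : Ultrafilter I, c ≤ ucof a U → s ∈ U →
      ∀ᶠ i in (U : Filter I), g i < f ζ i → g i < f ξ i := by
  set μ := Order.succ (Order.succ κ) with hμ
  by_contra! hcon
  have hcon' : ∀ ξ, ∃ (ζ : c.ord.ToType) (U : Ultrafilter I), c ≤ ucof a U ∧ s ∈ U ∧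
      ∀ᶠ i in (U : Filter I), g i < f ζ i ∧ f ξ i ≤ g i := fun ξ => by
    obtain ⟨ζ, -, U, hU, hsU, h⟩ := hcon ξ
    exact ⟨ζ, U, hU, hsU, h⟩
  choose nxt V hV hsV hnxt using hcon'
  obtain ⟨T, hT⟩ := exists_club_guessing H.isRegular_base
  have hμ0 : ℵ₀ ≤ μ := H.isRegular_base.aleph0_le.trans
    ((Order.le_succ κ).trans (Order.le_succ _))
  have hno := noMaxOrder_toType hμ0
  -- The quantifier over `k` is inside `∀ᶠ`: one set of indices must serve all guessed terms.
  let Q : μ.ord.ToType → (j : μ.ord.ToType) → (Set.Iio j → c.ord.ToType) → c.ord.ToType → Prop :=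
    fun α j p ζ => ∀ U : Ultrafilter I, c ≤ ucof a U → s ∈ U →
      ∀ᶠ i in (U : Filter I), ∀ k : Set.Iio j, k.1 ∈ T α → f (p k) i ≤ f ζ i
  have hQmono : ∀ α j p ζ ζ', ζ ≤ ζ' → Q α j p ζ → Q α j p ζ' := by
    intro α j p ζ ζ' hζ hQ U hU hsU
    filter_upwards [hQ U hU hsU, hf.eventually_le hζ hU] with i hi hi' k hk
    exact (hi k hk).trans hi'
  -- The right `α` is known only once `x` is complete, so all `κ⁺⁺ < c` guesses are provided for.
  have hN : ∀ j p, ∃ v, (∀ k, nxt (p k) ≤ v) ∧ ∀ α, (∃ ζ, Q α j p ζ) → Q α j p v := by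
    intro j p
    obtain ⟨v, hv⟩ := exists_forall_lt hc ((mk_Iio_lt j).trans hμc) fun k => nxt (p k)
    have : ∀ α, ∃ ζ, (∃ ζ, Q α j p ζ) → Q α j p ζ := fun α => by
      by_cases h : ∃ ζ, Q α j p ζ
      · exact h.imp fun ζ hζ _ => hζ
      · exact ⟨v, fun h' => absurd h' h⟩
    choose z hz using this
    obtain ⟨w, hw⟩ := exists_forall_lt hc (ι := μ.ord.ToType) (by simpa using hμc) z
    exact ⟨max v w, fun k => (hv k).le.trans (le_max_left _ _), fun α hα =>
      hQmono _ _ _ _ _ ((hw α).le.trans (le_max_right _ _)) (hz α hα)⟩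
  choose N hN1 hN2 using hN
  obtain ⟨x, hx, hxN⟩ := exists_normalSeq hc (M := μ.ord.ToType) (by simpa using hμc) N
  have hxsucc : ∀ j, N (Order.succ j) (fun k => x k) ≤ x (Order.succ j) := fun j =>
    hxN _ fun h => by
      obtain ⟨l, hl, hl'⟩ := h j (Order.lt_succ j)
      exact absurd (Order.succ_le_of_lt hl) (not_le.2 hl')
  obtain ⟨δ, hδ⟩ : ∃ δ, IsLUB (Set.range x) δ := by
    obtain ⟨b, hb⟩ := exists_forall_lt hc (ι := μ.ord.ToType) (by simpa using hμc) x
    exact exists_isLUB_of_bddAbove ⟨b, Set.forall_mem_range.2 fun k => (hb k).le⟩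
  obtain ⟨hdn, hdδ⟩ := hd δ x hx hδ
  obtain ⟨φ, hφ, hφeq⟩ := hx.exists_closurePoints_eq hdn hδ hdδ
  obtain ⟨α, hκα, hαcof, hαφ⟩ := hT φ
  have hxδ : ∀ j ∈ T α, ∀ i ∈ s, f (x j) i ≤ f δ i := fun j hj i hi => by
    rw [hφeq j (hαφ hj)]
    exact hfd δ j (hdn.lt_of_isLUB hdδ j) i hi
  have hnext : ∀ j : T α, ∃ j' ∈ T α, j.1 < j' ∧ ∀ l ∈ T α, j.1 < l → j' ≤ l := fun j => by
    have hne : {l | l ∈ T α ∧ j.1 < l}.Nonempty := hαcof j j.2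
    obtain ⟨h1, h2⟩ := wellFounded_lt.min_mem _ hne
    exact ⟨_, h1, h2, fun l hl hjl => wellFounded_lt.min_le 
      (show l ∈ {l | l ∈ T α ∧ j.1 < l} from ⟨hl, hjl⟩)⟩
  choose n hnT hlt hnle using hnext
  have hwit : ∀ j : T α, ∃ i, (∀ k ∈ T α, k ≤ j.1 → f (x k) i ≤ g i) ∧ g i < f (x (n j)) i := by
    intro j
    -- `δ` is a bound as required in `Q`; by the choice of `N`, so is already this term.
    have hQ : Q α (Order.succ j.1) (fun k => x k) (x (Order.succ j.1)) := by
      refine hQmono _ _ _ _ _ (hxsucc j) (hN2 _ _ _ ⟨δ, fun U hU hsU => ?_⟩)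
      filter_upwards [hsU] with i hi k hk using hxδ k hk i hi
    have hle : nxt (x (Order.succ j.1)) ≤ x (n j) := by
      have h1 := (hN1 (Order.succ (Order.succ j.1)) (fun k => x k)
        ⟨Order.succ j.1, Order.lt_succ (Order.succ j.1)⟩).trans (hxsucc _)
      refine h1.trans (hx.strictMono.monotone (Order.succ_le_of_lt ?_))
      exact (Order.succ_le_of_lt (hφ j)).trans_lt (hαφ (hnT j) j (hlt j))
    set ξ := x (Order.succ j.1) with hξ
    obtain ⟨i, ⟨h1, h2⟩, h3, h4⟩ := ((hnxt ξ).and ((hQ (V ξ) (hV ξ) (hsV ξ)).and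
      (hf.eventually_le hle (hV ξ)))).exists
    exact ⟨i, fun k hk hkj => (h3 ⟨k, Order.lt_succ_of_le hkj⟩ hk).trans h2, h1.trans_le h4⟩
  choose w hw1 hw2 using hwit
  have hne : ∀ j l : T α, j.1 < l.1 → w j ≠ w l := fun j l hjl he => by
    have h1 := hw1 l (n j) (hnT j) (hnle j l l.2 hjl)
    exact absurd (hw2 j) (not_lt.2 (he ▸ h1))
  have hinj : Function.Injective w := fun j l he => by
    rcases lt_trichotomy j.1 l.1 with h | h | h
    · exact absurd he (hne _ _ h)
    · exact Subtype.ext h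
    · exact absurd he.symm (hne _ _ h)
  exact absurd (hκα.trans (Cardinal.mk_le_of_injective hinj)) (not_le.2 H.card_lt)

/-- The existence of generators: there is a set that belongs to all ultrafilters with
cofinality `c` and to no ultrafilter with cofinality greater than `c`. -/
theorem exists_generator (H : IsProgressive a s κ) (c : Cardinal.{u}) :
    ∃ b : Set I, ∀ U : Ultrafilter I, (ucof a U = c → b ∈ U) ∧ (b ∈ U → ucof a U ≤ c) := by
  suffices h : ∃ b ⊆ s, ∀ U : Ultrafilter I, s ∈ U →
      (ucof a U = c → b ∈ U) ∧ (b ∈ U → ucof a U ≤ c) by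
    obtain ⟨b, hbs, hb⟩ := h
    refine ⟨b ∪ {i | i ∉ s ∧ a i = c}, fun U => ?_⟩
    rcases mem_or_eq_pure H.finite_compl U with hU | ⟨i, hi, rfl⟩
    · refine ⟨fun h => Filter.mem_of_superset ((hb U hU).1 h) Set.subset_union_left, fun h => ?_⟩
      refine (hb U hU).2 (Filter.mem_of_superset (Filter.inter_mem h hU) ?_)
      rintro i ⟨hi | hi, his⟩
      · exact hi
      · exact absurd his hi.1
    · have hi' : i ∉ s := hi
      rw [ucof_pure H.isRegular, Ultrafilter.mem_pure]
      exact ⟨fun h => .inr ⟨hi', h⟩, fun h => h.elim (fun h => absurd (hbs h) hi') fun h => h.2.le⟩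
  by_cases hex : ∃ U : Ultrafilter I, s ∈ U ∧ ucof a U = c
  swap
  · refine ⟨∅, Set.empty_subset _, fun U hU => ⟨fun h => absurd ⟨U, hU, h⟩ hex, fun h => ?_⟩⟩
    exact absurd h U.empty_notMem
  obtain ⟨U₀, hsU₀, hU₀⟩ := hex
  have hc : c.IsRegular := hU₀ ▸ ucof_isRegular H.isRegular U₀
  have hμc : Order.succ (Order.succ κ) < c :=
    hU₀ ▸ lt_ucof H.isRegular (Filter.mem_of_superset hsU₀ H.lt)
  have : ∀ δ : c.ord.ToType, ∃ d : (Order.succ (Order.succ κ)).ord.ToType → c.ord.ToType,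
      ∀ x : (Order.succ (Order.succ κ)).ord.ToType → c.ord.ToType,
        IsNormalSeq x → IsLUB (Set.range x) δ → IsNormalSeq d ∧ IsLUB (Set.range d) δ := fun δ => by
    by_cases h : ∃ x : (Order.succ (Order.succ κ)).ord.ToType → c.ord.ToType,
      IsNormalSeq x ∧ IsLUB (Set.range x) δ
    · exact h.imp fun d hd _ _ _ => hd
    · exact ⟨fun _ => δ, fun x hx hx' => absurd ⟨x, hx, hx'⟩ h⟩
  choose d hd using this
  obtain ⟨f, hf, hfu, hfd⟩ := H.exists_universal c
    (M := (Order.succ (Order.succ κ)).ord.ToType) (by simpa using H.lt) d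
  obtain ⟨g, hg⟩ := H.exists_bound (c := Order.succ c) (ι := c.ord.ToType)
    (by simp) f
  obtain ⟨ξ, hξ⟩ := H.exists_stable hc hμc hf d hd hfd g
  -- At cofinality `c` some term exceeds `g`, hence `f ξ` does by stability; above `c`, `g` exceeds
  -- `f ξ`.
  refine ⟨{i | i ∈ s ∧ g i < f ξ i}, fun i hi => hi.1, fun U hU => ⟨fun h => ?_, fun h => ?_⟩⟩
  · obtain ⟨ζ, hζ⟩ := hfu U h g
    have hζ' : ∀ᶠ i in (U : Filter I), g i < f (max ξ ζ) i := by
      filter_upwards [hζ, hf.eventually_le (le_max_right ξ ζ) h.ge] with i h1 h2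
      exact h1.trans_le h2
    filter_upwards [hU, hζ', hξ _ (le_max_left ξ ζ) U h.ge hU] with i h1 h2 h3
    exact ⟨h1, h3 h2⟩
  · by_contra! hlt
    have h1 : ∀ᶠ i in (U : Filter I), i ∈ s ∧ g i < f ξ i := h
    obtain ⟨i, h2, h3⟩ := (h1.and (hg ξ U (Order.succ_le_of_lt hlt))).exists
    exact lt_asymm h2.2 h3

end IsProgressive

end

/-! ### Compactness and the conclusions -/

section

variable {I : Type u} {a : I → Cardinal.{u}}

/-- For infinite `I`, the members up to `κ⁺⁺` are among three successors of `|I|`, and the members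
are distinct. -/
theorem exists_isProgressive (ha_inj : Function.Injective a) (ha_reg : ∀ i, (a i).IsRegular)
    (ha_card : ∀ i, #I < a i) : ∃ s κ, IsProgressive a s κ := by
  refine ⟨_, Order.succ (max #I ℵ₀), ha_reg, ha_inj, Cardinal.isRegular_succ (le_max_right _ _),
    (le_max_left _ _).trans_lt (Order.lt_succ _), fun i hi => hi, ?_⟩
  rcases finite_or_infinite I with hI | hI
  · exact Set.toFinite _
  rw [max_eq_left (Cardinal.infinite_iff.1 hI)]
  have : Set.Finite {Order.succ #I, Order.succ (Order.succ #I),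
    Order.succ (Order.succ (Order.succ #I))} := Set.toFinite _
  refine Set.Finite.of_finite_image (this.subset ?_) ha_inj.injOn
  rintro _ ⟨i, hi, rfl⟩
  have h1 : Order.succ #I ≤ a i := Order.succ_le_of_lt (ha_card i)
  have h2 : a i ≤ Order.succ (Order.succ (Order.succ #I)) := not_lt.1 hi
  simp only [Set.mem_insert_iff, Set.mem_singleton_iff]
  rcases h1.eq_or_lt with h1 | h1
  · exact .inl h1.symm
  rcases (Order.succ_le_of_lt h1).eq_or_lt with h3 | h3
  · exact .inr (.inl h3.symm)
  · exact .inr (.inr (le_antisymm h2 (Order.succ_le_of_lt h3)))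

/-- A family of sets that meets every ultrafilter has a finite subfamily that covers. -/
theorem exists_finset_cover {ι : Type*} (S : ι → Set I)
    (h : ∀ U : Ultrafilter I, ∃ x, S x ∈ U) : ∃ t : Finset ι, ∀ i, ∃ x ∈ t, i ∈ S x := by
  obtain ⟨t, ht⟩ := (isCompact_univ (X := Ultrafilter I)).elim_finite_subcover
    (fun x => {U | S x ∈ U}) (fun x => ultrafilter_isOpen_basic _) fun U _ => by
      simpa using h U
  refine ⟨t, fun i => ?_⟩
  simpa using ht (Set.mem_univ (pure i))

theorem exists_mem_of_cover {ι : Type*} {S : ι → Set I} {t : Finset ι}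
    (ht : ∀ i, ∃ x ∈ t, i ∈ S x) (U : Ultrafilter I) : ∃ x ∈ t, S x ∈ U := by
  refine (Ultrafilter.finite_biUnion_mem_iff t.finite_toSet).1
    (Filter.mem_of_superset (Filter.univ_mem (f := (U : Filter I))) fun i _ => ?_)
  simpa using ht i

/-- By compactness, `sᶜ` and finitely many members of `X` cover `I`. -/
theorem mem_idealGen {X : Set (Set I)} {s : Set I}
    (h : ∀ U : Ultrafilter I, s ∈ U → ∃ x ∈ X, x ∈ U) : s ∈ idealGen X := by
  rw [idealGen, Order.Ideal.mem_sInf]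
  intro J hJ
  obtain ⟨t, ht⟩ := exists_finset_cover (fun x : Option X => x.elim sᶜ Subtype.val) fun U => by
    rcases U.mem_or_compl_mem s with hs | hs
    · obtain ⟨x, hx, hxU⟩ := h U hs
      exact ⟨some ⟨x, hx⟩, hxU⟩
    · exact ⟨none, hs⟩
  have hmem : t.sup (fun x : Option X => x.elim ∅ Subtype.val) ∈ J := by
    rw [Order.Ideal.finsetSup_mem_iff]
    rintro (_ | x) -
    · exact J.bot_mem
    · exact hJ x.2
  refine J.lower (fun i hi => ?_) hmem
  obtain ⟨x, hx, hix⟩ := ht i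
  cases x with
  | none => exact absurd hi hix
  | some x =>
    have : x.1 ≤ t.sup (fun x : Option X => x.elim ∅ Subtype.val) :=
      Finset.le_sup (f := fun x : Option X => x.elim ∅ Subtype.val) hx
    exact this hix

theorem subset_idealGen (X : Set (Set I)) : X ⊆ (idealGen X : Set (Set I)) := fun x hx => by
  rw [SetLike.mem_coe, idealGen, Order.Ideal.mem_sInf]
  exact fun J hJ => hJ hx

theorem IsGenerators.spec (ha : ∀ i, (a i).IsRegular) {b : Cardinal.{u} → Set I}
    (hb : IsGenerators a b) {c : Cardinal.{u}} (hc : c ∈ pcf a) (U : Ultrafilter I) :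
    (ucof a U = c → b c ∈ U) ∧ (b c ∈ U → ucof a U ≤ c) := by
  obtain ⟨⟨-, h2⟩, h3⟩ := hb c hc
  refine ⟨fun h => ?_, fun h => h2 ((mem_pcfOn ha).2 ⟨U, h, rfl⟩)⟩
  by_contra hn
  exact h3 ((mem_pcfOn ha).2 ⟨U, Ultrafilter.compl_mem_iff_notMem.2 hn, h⟩)

theorem IsProgressive.exists_isGenerators {s : Set I} {κ : Cardinal.{u}}
    (H : IsProgressive a s κ) : ∃ b : Cardinal.{u} → Set I, IsGenerators a b := by
  choose b hb using H.exists_generator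
  refine ⟨b, fun c hc => ⟨⟨?_, ?_⟩, ?_⟩⟩
  · obtain ⟨U, hU⟩ := hc
    exact (mem_pcfOn H.isRegular).2 ⟨U, (hb c U).1 hU, hU⟩
  · intro d hd
    obtain ⟨U, hbU, rfl⟩ := (mem_pcfOn H.isRegular).1 hd
    exact (hb c U).2 hbU
  · intro h
    obtain ⟨U, hbU, hU⟩ := (mem_pcfOn H.isRegular).1 h
    exact absurd ((hb c U).1 hU) (Ultrafilter.compl_mem_iff_notMem.1 hbU)

/-- `b c` determines `c`, as the largest cofinality of an ultrafilter containing it. -/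
theorem IsGenerators.mk_pcf_le (ha : ∀ i, (a i).IsRegular) {b : Cardinal.{u} → Set I}
    (hb : IsGenerators a b) : #(pcf a) ≤ Cardinal.lift.{u + 1} (2 ^ #I) := by
  have hle : ∀ c ∈ pcf a, ∀ d ∈ pcf a, b c = b d → d ≤ c := by
    rintro c hc _ ⟨U, rfl⟩ h
    exact (hb.spec ha hc U).2 (h ▸ (hb.spec ha ⟨U, rfl⟩ U).1 rfl)
  have hinj : Function.Injective fun c : pcf a => b c := fun c d h =>
    Subtype.ext (le_antisymm (hle d d.2 c c.2 h.symm) (hle c c.2 d d.2 h))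
  have := Cardinal.mk_le_of_injective (α := pcf a) (β := ULift.{u + 1} (Set I))
    (f := fun c => ULift.up (b c)) fun c d h => hinj (ULift.up_injective h)
  simpa using this

theorem IsGenerators.exists_isGreatest [Nonempty I] (ha : ∀ i, (a i).IsRegular)
    {b : Cardinal.{u} → Set I} (hb : IsGenerators a b) : ∃ m, IsGreatest (pcf a) m := by
  obtain ⟨t, ht⟩ := exists_finset_cover (fun c : pcf a => b c) fun U =>
    ⟨⟨ucof a U, U, rfl⟩, (hb.spec ha ⟨U, rfl⟩ U).1 rfl⟩
  have hne : t.Nonempty := by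
    obtain ⟨x, hx, -⟩ := ht (Classical.arbitrary I)
    exact ⟨x, hx⟩
  obtain ⟨m, -, hmax⟩ := t.exists_max_image (fun c => c.1) hne
  refine ⟨m, m.2, ?_⟩
  rintro _ ⟨U, rfl⟩
  obtain ⟨x, hx, hxU⟩ := exists_mem_of_cover ht U
  exact ((hb.spec ha x.2 U).2 hxU).trans (hmax x hx)

theorem exists_le_of_list {T : Type v} (ha : ∀ i, (a i).IsRegular) (F : T → CartProd a)
    (l : List T) : ∃ g : CartProd a, ∀ x ∈ l, ∀ i, F x i ≤ g i := by
  induction l with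
  | nil => exact (nonempty_cartProd ha).elim fun g => ⟨g, by simp⟩
  | cons x l ih =>
    obtain ⟨g, hg⟩ := ih
    refine ⟨fun i => max (F x i) (g i), fun y hy i => ?_⟩
    rcases List.mem_cons.1 hy with rfl | hy
    · exact le_max_left _ _
    · exact (hg y hy i).trans (le_max_right _ _)

/-- By compactness, upper bounds of finite lists of universal terms are cofinal, and at most `m` are
needed. -/
theorem IsProgressive.cof_cartProd {s : Set I} {κ : Cardinal.{u}} (H : IsProgressive a s κ)
    {m : Cardinal.{u}} (hm : IsGreatest (pcf a) m) : Order.cof (CartProd a) = m := by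
  have hm0 : ℵ₀ ≤ m := by
    obtain ⟨U, rfl⟩ := hm.1
    exact (ucof_isRegular H.isRegular U).aleph0_le
  refine le_antisymm ?_ ?_
  · choose f _ hfu _ using fun c : Cardinal.{u} => H.exists_universal c (M := PEmpty.{u + 1})
      (fun i _ => by simpa using (H.isRegular i).pos) (fun ξ _ => ξ)
    let T := Σ c : pcf a, c.1.ord.ToType
    choose D hD using exists_le_of_list H.isRegular fun x : T => f x.1 x.2
    have hcof : IsCofinal (Set.range D) := fun g => by
      obtain ⟨t, ht⟩ := exists_finset_cover (fun x : T => {i | g i < f x.1 x.2 i}) fun U => by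
        obtain ⟨ξ, hξ⟩ := hfu (ucof a U) U rfl g
        exact ⟨⟨⟨_, U, rfl⟩, ξ⟩, hξ⟩
      refine ⟨D t.toList, ⟨_, rfl⟩, fun i => ?_⟩
      obtain ⟨x, hx, hi⟩ := ht i
      exact (show g i < _ from hi).le.trans (hD _ x (by simpa using hx) i)
    refine (Order.cof_le hcof).trans ?_
    have he : ∀ c : pcf a, Nonempty (c.1.ord.ToType ↪ m.ord.ToType) := fun c => by
      rw [← Cardinal.le_def]
      simpa using hm.2 c.2
    -- The bound `2 ^ #I` may exceed `m`; counting the ordinals up to `m` suffices.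
    have hpcf : #(pcf a) ≤ Cardinal.lift.{u + 1} m := by
      have h1 : Function.Injective fun c : pcf a =>
          (⟨c.1.ord, Order.lt_add_one_iff.2 (Cardinal.ord_le_ord.2 (hm.2 c.2))⟩ :
            Set.Iio (m.ord + 1)) := fun c d h => by
        simpa [Subtype.ext_iff] using h
      refine (Cardinal.mk_le_of_injective h1).trans ?_
      rw [Cardinal.mk_Iio_ordinal, Cardinal.lift_le, Ordinal.card_add_one, Cardinal.card_ord,
        Cardinal.add_one_eq hm0]
    have hT : #T ≤ Cardinal.lift.{u + 1} m := by
      have h1 : Function.Injective fun x : T =>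
          ((x.1, ULift.up ((he x.1).some x.2)) : pcf a × ULift.{u + 1} m.ord.ToType) := by
        rintro ⟨c, ξ⟩ ⟨d, η⟩ h
        simp only [Prod.mk.injEq] at h
        obtain ⟨rfl, h⟩ := h
        rw [(he c).some.injective (ULift.up_injective h)]
      refine (Cardinal.mk_le_of_injective h1).trans ?_
      rw [Cardinal.mk_prod, Cardinal.lift_id, Cardinal.lift_id, Cardinal.mk_uLift,
        Cardinal.mk_ord_toType]
      exact (mul_le_mul_left hpcf _).trans
        (Cardinal.mul_eq_self (by simpa using hm0)).le
    have h2 := Cardinal.mk_range_le_lift (f := D)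
    rw [Cardinal.lift_id'.{u, u + 1}] at h2
    rw [← Cardinal.lift_le.{u + 1}]
    exact h2.trans ((Cardinal.mk_list_le_max T).trans (max_le (by simpa using hm0) hT))
  · obtain ⟨U, rfl⟩ := hm.1
    obtain ⟨D, hD, hDc⟩ := Order.exists_cof_eq (CartProd a)
    rw [← hDc]
    refine ucof_le (fun x : D => x.1) fun g => ?_
    obtain ⟨h, hh, hle⟩ := hD g
    exact ⟨⟨h, hh⟩, Filter.Eventually.of_forall hle⟩

/-- A universal sequence works. Ultrafilters that contain `b c` and have cofinality at least `c`
have cofinality exactly `c`, so a term exceeds `g` there; by compactness finitely many terms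
suffice, and any later index serves for all. -/
theorem IsProgressive.exists_scale {s : Set I} {κ : Cardinal.{u}} (H : IsProgressive a s κ)
    {b : Cardinal.{u} → Set I} (hb : IsGenerators a b) {c : Cardinal.{u}} (hc : c ∈ pcf a) :
    ∃ f : c.ord.ToType → CartProd a,
      (∀ i j, i < j → LtMod (lowerIdeal a b c) (f i) (f j)) ∧
      ∀ g : CartProd a, ∃ i,
        LtMod (idealGen ((lowerIdeal a b c : Set (Set I)) ∪ {(b c)ᶜ})) g (f i) := by
  obtain ⟨f, hf, hfu, -⟩ := H.exists_universal c (M := PEmpty.{u + 1})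
    (fun i _ => by simpa using (H.isRegular i).pos) (fun ξ _ => ξ)
  have hlow : ∀ U : Ultrafilter I, ucof a U < c →
      ∃ x ∈ {x | ∃ ν ∈ pcf a, ν < c ∧ x = b ν}, x ∈ U := fun U hU =>
    ⟨_, ⟨ucof a U, ⟨U, rfl⟩, hU, rfl⟩, (hb.spec H.isRegular ⟨U, rfl⟩ U).1 rfl⟩
  have hlow' : ∀ U : Ultrafilter I, ucof a U < c →
      ∃ x ∈ (lowerIdeal a b c : Set (Set I)) ∪ {(b c)ᶜ}, x ∈ U := fun U hU => by
    obtain ⟨x, hx, hxU⟩ := hlow U hU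
    exact ⟨x, .inl (subset_idealGen _ hx), hxU⟩
  refine ⟨f, fun i j hij => mem_idealGen fun U hU => hlow U ?_, fun g => ?_⟩
  · by_contra! hle
    obtain ⟨k, hk, hk'⟩ := ((hf j i hij U hle).and (show ∀ᶠ k in (U : Filter I), _ from hU)).exists
    exact hk' hk
  · let X : Set (Set I) := (lowerIdeal a b c : Set (Set I)) ∪ {(b c)ᶜ}
    obtain ⟨t, ht⟩ := exists_finset_cover
      (fun x : c.ord.ToType ⊕ X => x.elim (fun ξ => {i | g i < f ξ i}) Subtype.val) fun U => by
        rcases lt_or_ge (ucof a U) c with h | h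
        · obtain ⟨x, hx, hxU⟩ := hlow' U h
          exact ⟨.inr ⟨x, hx⟩, hxU⟩
        rcases U.mem_or_compl_mem (b c) with h' | h'
        · obtain ⟨ξ, hξ⟩ := hfu U (le_antisymm ((hb.spec H.isRegular hc U).2 h') h) g
          exact ⟨.inl ξ, hξ⟩
        · exact ⟨.inr ⟨_, .inr rfl⟩, h'⟩
    have : Nonempty c.ord.ToType := by
      obtain ⟨U, rfl⟩ := hc
      obtain ⟨ξ, -⟩ := hfu U rfl (nonempty_cartProd H.isRegular).some
      exact ⟨ξ⟩
    obtain ⟨ζ, hζ⟩ := t.toLeft.exists_le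
    refine ⟨ζ, mem_idealGen fun U hU => ?_⟩
    by_contra! hX
    have hle : c ≤ ucof a U := by
      by_contra! h
      obtain ⟨x, hx, hxU⟩ := hlow' U h
      exact hX x hx hxU
    obtain ⟨x, hx, hxU⟩ := exists_mem_of_cover ht U
    rcases x with ξ | x
    · have h1 : ∀ᶠ i in (U : Filter I), g i < f ξ i := hxU
      have h2 : ∀ᶠ i in (U : Filter I), ¬ g i < f ζ i := hU
      obtain ⟨i, h3, h4, h5⟩ := (h1.and (h2.and (hf.eventually_le
        (hζ ξ (by simpa using hx)) hle))).exists
      exact h4 (h3.trans_le h5)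
    · exact hX x x.2 hxU

end

end PCF

theorem mainTheorem4 {I : Type u} [Nonempty I] (a : I → Cardinal.{u})
    (ha_inj : Function.Injective a) (ha_reg : ∀ i, (a i).IsRegular) (ha_card : ∀ i, #I < a i) :
    #(PCF.pcf a) ≤ Cardinal.lift.{u + 1} (2 ^ #I) ∧
    (∃ m, IsGreatest (PCF.pcf a) m ∧ Order.cof (PCF.CartProd a) = m) ∧
    (∃ b : Cardinal.{u} → Set I, PCF.IsGenerators a b) ∧
    (∀ b : Cardinal.{u} → Set I, PCF.IsGenerators a b → ∀ μ ∈ PCF.pcf a,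
      ∃ f : μ.ord.ToType → PCF.CartProd a,
        (∀ i j, i < j → PCF.LtMod (PCF.lowerIdeal a b μ) (f i) (f j)) ∧
        (∀ g : PCF.CartProd a, ∃ i,
          PCF.LtMod (PCF.idealGen ((PCF.lowerIdeal a b μ : Set (Set I)) ∪ {(b μ)ᶜ})) g (f i))) :=
  by
  obtain ⟨s, κ, H⟩ := PCF.exists_isProgressive ha_inj ha_reg ha_card
  obtain ⟨b, hb⟩ := H.exists_isGenerators
  obtain ⟨m, hm⟩ := hb.exists_isGreatest ha_reg
  exact ⟨hb.mk_pcf_le ha_reg, ⟨m, hm, H.cof_cartProd hm⟩, ⟨b, hb⟩,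
    fun b hb μ hμ => H.exists_scale hb hμ⟩
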